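/- For a finite simple graph $\Gamma$ with adjacency matrix $A$, let $H(t)=\exp(-\mathbf{i}tA)$ $(t\in\mathbb{R})$, and let $\mathbf{e}_a$ be the standard basis vector of a vertex $a$. We say that $\Gamma$ admits fractional revival (FR) at time $t>0$ if there are distinct vertices $a,b$ and complex numbers $\alpha,\beta$ with $\beta\neq 0$ and $|\alpha|^2+|\beta|^2=1$ such that $H(t)\mathbf{e}_a=\alpha\mathbf{e}_a+\beta\mathbf{e}_b$. It admits FR if it admits FR at some time $t>0$. It admits pretty good fractional revival (PGFR) if there are distinct vertices $a,b$, complex numbers $\alpha,\beta$ with $\beta\ne 0$ and $|\alpha|^2+|\beta|^2=1$, and a sequence $(t_k)$ of real numbers with $\lim_{k\to\infty}H(t_k)\mathbf{e}_a=\alpha\mathbf{e}_a+\beta\mathbf{e}_b$. For a positive integer $n$, the unitary Cayley graph $X_n$ has vertex set $\mathbb{Z}_n$, and two distinct vertices $a,b$ are adjacent if and only if $a-b=u$ in $\mathbb{Z}_n$ for some integer $u$ with $1\le u\le n-1$ and $\gcd(u,n)=1$. Theorem. Let $n$ be a positive integer. Then: (i) $X_n$ admits FR if and only if it admits PGFR;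 (ii) $X_n$ admits PGFR if and only if $n=2$ or $n=2p$ for some prime $p$; (iii) if $n=2p$ with $p$ an odd prime, then $X_n$ admits FR at time $2\pi/p$. -/

import Mathlib

noncomputable section

open scoped Matrix Topology

namespace QuantumWalk

variable {V : Type*} [Fintype V] [DecidableEq V]

open Classical in
/-- The transition matrix `H(t) = exp(-i t A)` of a finite simple graph, `A` being its adjacency
matrix. -/
def transitionMatrix (G : SimpleGraph V) (t : ℝ) : Matrix V V ℂ :=
  NormedSpace.exp ((-(Complex.I * (t : ℂ))) • G.adjMatrix ℂ)

/-- The column vector `e_a`. -/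
def stdVec (a : V) : V → ℂ := Pi.single a 1

/-- Fractional revival from `a` to another vertex `b` at the time `t > 0`. -/
def HasFRAt (G : SimpleGraph V) (a b : V) (t : ℝ) : Prop :=
  a ≠ b ∧ 0 < t ∧ ∃ α β : ℂ, β ≠ 0 ∧ ‖α‖ ^ 2 + ‖β‖ ^ 2 = 1 ∧
    transitionMatrix G t *ᵥ stdVec a = α • stdVec a + β • stdVec b

/-- The graph admits fractional revival at time `t` (between some two vertices). -/
def AdmitsFRAt (G : SimpleGraph V) (t : ℝ) : Prop :=
  ∃ a b : V, HasFRAt G a b t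

/-- The graph admits fractional revival. -/
def AdmitsFR (G : SimpleGraph V) : Prop :=
  ∃ t : ℝ, AdmitsFRAt G t

/-- Pretty good fractional revival from `a` to another vertex `b`. -/
def HasPGFR (G : SimpleGraph V) (a b : V) : Prop :=
  a ≠ b ∧ ∃ α β : ℂ, β ≠ 0 ∧ ‖α‖ ^ 2 + ‖β‖ ^ 2 = 1 ∧ ∃ t : ℕ → ℝ,
    Filter.Tendsto (fun k => transitionMatrix G (t k) *ᵥ stdVec a) Filter.atTop
      (𝓝 (α • stdVec a + β • stdVec b))

/-- The graph admits pretty good fractional revival. -/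
def AdmitsPGFR (G : SimpleGraph V) : Prop :=
  ∃ a b : V, HasPGFR G a b

/-- The connection set `U(n) = {u : 1 ≤ u ≤ n - 1, gcd(u, n) = 1}`, as a subset of `ℤ/nℤ`. -/
def unitSet (n : ℕ) : Set (ZMod n) :=
  {x | ∃ u : ℕ, 1 ≤ u ∧ u < n ∧ Nat.gcd u n = 1 ∧ x = (u : ZMod n)}

/-- The unitary Cayley graph `X_n = Cay(ℤ/nℤ, U(n))`. -/
def unitaryCayleyGraph (n : ℕ) : SimpleGraph (ZMod n) :=
  SimpleGraph.circulantGraph (unitSet n)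

end QuantumWalk

end

/-!
The graph `X_n` is circulant, so the additive characters of `ℤ/nℤ` diagonalize it; its eigenvalues
are `c_j = ∑ ψ(j y)`, the sum running over the units `y`, where `ψ` is the standard character
(`dft_transitionMatrix_mulVec`).

*Necessity.* Taking discrete Fourier transforms, pretty good fractional revival from `a` to `b`
along `(t_k)` says that `exp(-i t_k c_j)` tends to `L j = α + β ψ(d j)` for every `j`, with
`d = a - b ≠ 0` and `β ≠ 0` (`HasPGFR.exists_tendsto`). Since `c_{-j} = c_j`, it follows that
`2 d = 0`; so `n` is even, `L` only depends on the parity of `j`, and its two values `α + β` and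
`α - β` differ. Every vanishing sum of eigenvalues gives a product of values of `L` equal to `1`
(`prod_eq_one_of_tendsto_of_sum_eigenvalue_eq_zero`), and three such relations are enough:

* translation by a nilpotent `x` permutes the units, so `c_j = 0` as soon as `j x ≠ 0`
  (`eigenvalue_eq_zero_of_isNilpotent`). If also `2 x ≠ 0`, then `L 1 = L 2 = 1`, which is
  impossible; this excludes `8 ∣ n` and `p² ∣ n` for an odd prime `p`;
* if `n = p m` with `p > 1`, then `∑_{k < p} c_{j + m k} = 0` (`sum_eigenvalue_add_mul_eq_zero`);
  for an odd prime `p` the indices all have the parity of `j`, so `L j ^ p = 1`. Two distinct odd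
  primes would force `L = 1`;
* `c_d = -c_0` (`eigenvalue_eq_neg_eigenvalue_zero`); if `4 ∣ n`, then `d` is even, so that
  `L 0 ^ 2 = 1`, and `d` is nilpotent, so that `L 1 = 1`. An odd prime divisor would force
  `L 0 = 1 = L 1`.

What is left is `n = 2`, `n = 4` and `n = 2 p` with `p` an odd prime.

*Sufficiency.* For `n = 2 p` with `p` odd, an element of `ℤ/nℤ` is a unit iff it is odd and
different from `p`; Fourier inversion then gives `c_j = p ([j = 0] - [j = p]) - (-1)^j`, so at time
`t = 2π/p` the eigenvalues of `H(t)` are `cos t + i (-1)^j sin t`, which is fractional revival from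
`0` to `p`, since `sin t ≠ 0`. The cases `n = 2` and `n = 4` are settled at time `π/2`.
-/

namespace QuantumWalk

open Complex Filter
open ZMod (stdAddChar dft_apply)
open scoped Matrix Topology ZMod

/-! ### Eigenvalues and the Fourier transform of the transition matrix -/

theorem vecMul_exp_of_vecMul_eq_smul {m : Type*} [Fintype m] [DecidableEq m]
    {M : Matrix m m ℂ} {v : m → ℂ} {c : ℂ} (h : v ᵥ* M = c • v) :
    v ᵥ* NormedSpace.exp M = cexp c • v := by
  have hpow (k : ℕ) : v ᵥ* M ^ k = c ^ k • v := by
    induction k with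
    | zero => simp
    | succ k ih =>
      rw [pow_succ, ← Matrix.vecMul_vecMul, ih, Matrix.smul_vecMul, h, smul_smul, pow_succ]
  have hM : HasSum (fun k : ℕ => ((k.factorial : ℂ)⁻¹) • M ^ k) (NormedSpace.exp M) := by
    open scoped Matrix.Norms.Operator in
    exact NormedSpace.exp_series_hasSum_exp' (𝕂 := ℂ) M
  have hM' := hM.map (AddMonoidHom.mk' (fun N : Matrix m m ℂ => v ᵥ* N)
      (fun A B => Matrix.vecMul_add A B v))
    (continuous_const.matrix_vecMul continuous_id)
  have hc : HasSum (fun k : ℕ => ((k.factorial : ℂ)⁻¹) • c ^ k) (cexp c) := by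
    rw [Complex.exp_eq_exp_ℂ]
    exact NormedSpace.exp_series_hasSum_exp' (𝕂 := ℂ) c
  refine hM'.unique ?_
  convert hc.smul_const v using 2 with k
  simp [Matrix.vecMul_smul, hpow, smul_smul]

variable {n : ℕ} [NeZero n]

open Classical in
/-- The eigenvalue of the unitary Cayley graph `X_n` at the character `y ↦ ψ(j y)`, where `ψ` is the
standard additive character of `ℤ/nℤ` (a Ramanujan sum). -/
noncomputable def eigenvalue (n : ℕ) [NeZero n] (j : ZMod n) : ℂ :=
  ∑ y : ZMod n, if IsUnit y then stdAddChar (j * y) else 0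

theorem mem_unitSet_iff (hn : 1 < n) (x : ZMod n) : x ∈ unitSet n ↔ IsUnit x := by
  constructor
  · rintro ⟨u, -, -, hu, rfl⟩
    exact (ZMod.isUnit_iff_coprime u n).2 hu
  · intro hx
    have hx' : IsUnit ((x.val : ℕ) : ZMod n) := by simpa using hx
    have hc := (ZMod.isUnit_iff_coprime _ n).1 hx'
    refine ⟨x.val, ?_, x.val_lt, hc, by simp⟩
    rcases Nat.eq_zero_or_pos x.val with h | h
    · rw [h] at hc
      simp at hc
      omega
    · exact h

theorem unitaryCayleyGraph_adj (hn : 1 < n) (a b : ZMod n) :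
    (unitaryCayleyGraph n).Adj a b ↔ IsUnit (a - b) := by
  have : Fact (1 < n) := ⟨hn⟩
  rw [unitaryCayleyGraph, SimpleGraph.circulantGraph_adj, mem_unitSet_iff hn, mem_unitSet_iff hn,
    ← neg_sub a b, IsUnit.neg_iff, or_self, and_iff_right_iff_imp]
  rintro h rfl
  simp at h

theorem eigenvalue_neg (j : ZMod n) : eigenvalue n (-j) = eigenvalue n j := by
  unfold eigenvalue
  refine Fintype.sum_equiv (Equiv.neg _) _ _ fun y => ?_
  simp [IsUnit.neg_iff]

theorem dft_transitionMatrix_mulVec (hn : 1 < n) (t : ℝ) (a j : ZMod n) :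
    𝓕 (transitionMatrix (unitaryCayleyGraph n) t *ᵥ stdVec a) j =
      cexp (-(I * t) * eigenvalue n j) * stdAddChar (-(a * j)) := by
  classical
  -- The character `v` is a left eigenvector of the adjacency matrix.
  set v : ZMod n → ℂ := fun x => stdAddChar (-(x * j)) with hv
  have hvec : v ᵥ* ((-(I * (t : ℂ))) • (unitaryCayleyGraph n).adjMatrix ℂ) =
      (-(I * t) * eigenvalue n j) • v := by
    rw [Matrix.vecMul_smul, mul_smul]
    congr 1
    ext b
    simp only [Matrix.vecMul, dotProduct, SimpleGraph.adjMatrix_apply, Pi.smul_apply, smul_eq_mul,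
      unitaryCayleyGraph_adj hn, mul_ite, mul_one, mul_zero]
    rw [← eigenvalue_neg, eigenvalue, Finset.sum_mul]
    refine Fintype.sum_equiv (Equiv.subRight b) _ _ fun y => ?_
    simp only [Equiv.subRight_apply, ite_mul, zero_mul, hv, ← AddChar.map_add_eq_mul]
    congr 2
    ring
  have h := vecMul_exp_of_vecMul_eq_smul hvec
  have h2 : 𝓕 (transitionMatrix (unitaryCayleyGraph n) t *ᵥ stdVec a) j =
      v ⬝ᵥ (transitionMatrix (unitaryCayleyGraph n) t *ᵥ stdVec a) := by
    simp [dft_apply, dotProduct, hv]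
  rw [h2, Matrix.dotProduct_mulVec]
  have h3 : transitionMatrix (unitaryCayleyGraph n) t =
    NormedSpace.exp ((-(I * (t : ℂ))) • (unitaryCayleyGraph n).adjMatrix ℂ) := by
    unfold transitionMatrix
    congr!
  rw [h3, h, stdVec, dotProduct_single_one]
  simp [hv]

theorem dft_stdVec (a j : ZMod n) : 𝓕 (stdVec a : ZMod n → ℂ) j = stdAddChar (-(a * j)) := by
  simp [dft_apply, stdVec, Pi.single_apply]

/-- Fractional revival read off on the Fourier side, where `H(t)` acts diagonally. -/
theorem hasFRAt_zero_of_exp_eq (hn : 1 < n) {t : ℝ} (ht : 0 < t) {b : ZMod n} (hb : b ≠ 0)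
    {α β : ℂ} (hβ : β ≠ 0) (hαβ : ‖α‖ ^ 2 + ‖β‖ ^ 2 = 1)
    (h : ∀ j, cexp (-(I * t) * eigenvalue n j) = α + β * stdAddChar (-(b * j))) :
    HasFRAt (unitaryCayleyGraph n) 0 b t := by
  refine ⟨hb.symm, ht, α, β, hβ, hαβ, ZMod.dft.injective ?_⟩
  ext j
  rw [dft_transitionMatrix_mulVec hn, h, map_add, map_smul, map_smul]
  simp [dft_stdVec]

/-- Pretty good fractional revival on the Fourier side. The `j`-th Fourier coefficient is multiplied
by `ψ(a j)`, so that only the difference `a - b` remains. -/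
theorem HasPGFR.exists_tendsto (hn : 1 < n) {a b : ZMod n}
    (h : HasPGFR (unitaryCayleyGraph n) a b) :
    ∃ α β : ℂ, β ≠ 0 ∧ ∃ t : ℕ → ℝ, ∀ j, Tendsto (fun k => cexp (-(I * t k) * eigenvalue n j)) atTop
      (𝓝 (α + β * stdAddChar ((a - b) * j))) := by
  obtain ⟨-, α, β, hβ, -, t, ht⟩ := h
  refine ⟨α, β, hβ, t, fun j => ?_⟩
  have hcont : Continuous fun Φ : ZMod n → ℂ => 𝓕 Φ j := by
    simp only [dft_apply]
    fun_prop
  have h := ((hcont.tendsto _).comp ht).const_mul (stdAddChar (a * j))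
  convert h using 2 with k
  · simp only [Function.comp_apply]
    rw [dft_transitionMatrix_mulVec hn, mul_left_comm, ← AddChar.map_add_eq_mul]
    simp
  · rw [map_add, map_smul, map_smul]
    simp only [Pi.add_apply, Pi.smul_apply, dft_stdVec, smul_eq_mul, mul_add]
    rw [mul_left_comm, mul_left_comm _ β, ← AddChar.map_add_eq_mul, ← AddChar.map_add_eq_mul]
    rw [sub_mul, sub_eq_add_neg]
    simp

/-! ### Linear relations between the eigenvalues -/

theorem stdAddChar_eq_one_iff (x : ZMod n) : (stdAddChar x : ℂ) = 1 ↔ x = 0 := by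
  rw [← AddChar.map_zero_eq_one (stdAddChar : AddChar (ZMod n) ℂ)]
  exact ZMod.injective_stdAddChar.eq_iff

theorem stdAddChar_eq_neg_one {x : ZMod n} (hx : x ≠ 0) (h2 : x + x = 0) :
    (stdAddChar x : ℂ) = -1 := by
  have h : (stdAddChar x : ℂ) * stdAddChar x = 1 := by
    rw [← AddChar.map_add_eq_mul, h2, AddChar.map_zero_eq_one]
  exact (mul_self_eq_one_iff.1 h).resolve_left ((stdAddChar_eq_one_iff x).not.2 hx)

/-- Translation by a nilpotent `x` permutes the units and multiplies the character by
`ψ(j x) ≠ 1`. -/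
theorem eigenvalue_eq_zero_of_isNilpotent {x j : ZMod n} (hx : IsNilpotent x) (hj : j * x ≠ 0) :
    eigenvalue n j = 0 := by
  have h : eigenvalue n j = stdAddChar (j * x) * eigenvalue n j := by
    conv_lhs => unfold eigenvalue
    rw [eigenvalue, Finset.mul_sum]
    refine Fintype.sum_equiv (Equiv.subRight x) _ _ fun y => ?_
    have hu : IsUnit (y - x) ↔ IsUnit y := by
      refine ⟨fun h => ?_, fun h => ?_⟩
      · simpa using hx.isUnit_add_right_of_commute h (Commute.all _ _)
      · rw [sub_eq_add_neg]
        exact hx.neg.isUnit_add_left_of_commute h (Commute.all _ _)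
    simp only [Equiv.subRight_apply, hu, mul_ite, mul_zero, ← AddChar.map_add_eq_mul]
    congr 2
    ring
  by_contra hne
  exact hj ((stdAddChar_eq_one_iff _).1 (mul_eq_right₀ hne |>.1 h.symm))

/-- For a unit `y`, `ψ(m y)` is a `p`-th root of unity different from `1`, so its powers sum
to `0`. -/
theorem sum_eigenvalue_add_mul_eq_zero {p m : ℕ} (hp : 1 < p) (hn : n = p * m) (j : ZMod n) :
    ∑ k ∈ Finset.range p, eigenvalue n (j + m * (k : ZMod n)) = 0 := by
  have hn0 : n ≠ 0 := NeZero.ne n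
  have hm0 : 0 < m := by
    rcases Nat.eq_zero_or_pos m with rfl | h
    · simp [hn] at hn0
    · exact h
  have hm : (m : ZMod n) ≠ 0 := by
    rw [Ne, ZMod.natCast_eq_zero_iff]
    intro h
    have := Nat.le_of_dvd hm0 h
    nlinarith
  have hpm : (p : ZMod n) * m = 0 := by
    rw [← Nat.cast_mul, ← hn, ZMod.natCast_self]
  unfold eigenvalue
  rw [Finset.sum_comm]
  refine Finset.sum_eq_zero fun y _ => ?_
  split_ifs with hy
  · have hpow (k : ℕ) : (stdAddChar ((j + (m : ZMod n) * (k : ZMod n)) * y) : ℂ) =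
        stdAddChar (j * y) * stdAddChar ((m : ZMod n) * y) ^ k := by
      rw [← AddChar.map_nsmul_eq_pow, ← AddChar.map_add_eq_mul, nsmul_eq_mul]
      congr 1
      ring
    simp only [hpow]
    have h1 : (stdAddChar ((m : ZMod n) * y) : ℂ) - 1 ≠ 0 := by
      rw [sub_ne_zero, Ne, stdAddChar_eq_one_iff, hy.mul_left_eq_zero]
      exact hm
    have h2 : (stdAddChar ((m : ZMod n) * y) : ℂ) ^ p - 1 = 0 := by
      rw [← AddChar.map_nsmul_eq_pow, nsmul_eq_mul, ← mul_assoc, hpm, zero_mul,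
        AddChar.map_zero_eq_one, sub_self]
    rw [← Finset.mul_sum, (mul_eq_zero.1 ((geom_sum_mul _ p).trans h2)).resolve_right h1, mul_zero]
  · simp

/-- An element `d` of order two is sent by every unit to an element of order two, where the
character takes the value `-1`. -/
theorem eigenvalue_eq_neg_eigenvalue_zero {d : ZMod n} (hd : d ≠ 0) (h2 : d + d = 0) :
    eigenvalue n d = -eigenvalue n 0 := by
  unfold eigenvalue
  rw [← Finset.sum_neg_distrib]
  refine Finset.sum_congr rfl fun y _ => ?_
  split_ifs with hy
  · rw [stdAddChar_eq_neg_one (hy.mul_left_eq_zero.not.2 hd) (by rw [← add_mul, h2, zero_mul])]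
    simp
  · simp

/-! ### Necessity of the condition on `n` -/

/-- A vanishing sum of eigenvalues becomes a multiplicative relation between the limits of
`exp(-i t_k c_j)`. -/
theorem prod_eq_one_of_tendsto_of_sum_eigenvalue_eq_zero {t : ℕ → ℝ} {L : ZMod n → ℂ}
    (hL : ∀ j, Tendsto (fun k => cexp (-(I * t k) * eigenvalue n j)) atTop (𝓝 (L j)))
    {ι : Type*} (s : Finset ι) (f : ι → ZMod n) (hf : ∑ i ∈ s, eigenvalue n (f i) = 0) :
    ∏ i ∈ s, L (f i) = 1 := by
  refine tendsto_nhds_unique (tendsto_finsetProd s fun i _ => hL (f i)) ?_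
  simp only [← Complex.exp_sum, ← Finset.mul_sum, hf, mul_zero, Complex.exp_zero]
  exact tendsto_const_nhds

theorem exists_isNilpotent_two_mul_ne_zero {k l e : ℕ} (hk : 2 < k) (hn : n = k * l)
    (he : n ∣ l ^ e) : ∃ x : ZMod n, IsNilpotent x ∧ 2 * x ≠ 0 := by
  refine ⟨l, ⟨e, ?_⟩, ?_⟩
  · rw [← Nat.cast_pow, ZMod.natCast_eq_zero_iff]
    exact he
  · have h0 : n ≠ 0 := NeZero.ne n
    have hl : 0 < l := Nat.pos_of_ne_zero fun h => h0 (by simp [hn, h])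
    rw [← Nat.cast_two, ← Nat.cast_mul, Ne, ZMod.natCast_eq_zero_iff]
    intro h
    have := Nat.le_of_dvd (by omega) h
    nlinarith

theorem HasPGFR.eq_two_mul_prime {a b : ZMod n} (h : HasPGFR (unitaryCayleyGraph n) a b) :
    n = 2 ∨ ∃ p : ℕ, p.Prime ∧ n = 2 * p := by
  have hn : 1 < n := by
    by_contra! hle
    have : n = 1 := by have := NeZero.pos n; omega
    subst this
    exact h.1 (Subsingleton.elim _ _)
  obtain ⟨α, β, hβ, t, hL⟩ := h.exists_tendsto hn
  have hd : a - b ≠ 0 := sub_ne_zero.2 h.1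
  generalize a - b = d at hL hd
  set L : ZMod n → ℂ := fun j => α + β * stdAddChar (d * j) with hLdef
  have hprod {ι : Type} (s : Finset ι) (f : ι → ZMod n)
      (hf : ∑ i ∈ s, eigenvalue n (f i) = 0) : ∏ i ∈ s, L (f i) = 1 :=
    prod_eq_one_of_tendsto_of_sum_eigenvalue_eq_zero hL s f hf
  have hone {j : ZMod n} (hj : eigenvalue n j = 0) : L j = 1 := by
    simpa using hprod {()} (fun _ => j) (by simpa using hj)
  -- `c_1 = c_{-1}` forces `ψ(d) = ψ(-d)`.
  have hdd : d + d = 0 := by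
    have h1 : L 1 = L (-1) := by
      refine tendsto_nhds_unique (hL 1) ?_
      simpa only [eigenvalue_neg] using hL (-1)
    have h2 : d * 1 = d * -1 :=
      ZMod.injective_stdAddChar (mul_left_cancel₀ hβ (add_left_cancel h1))
    rw [mul_one, mul_neg, mul_one] at h2
    exact eq_neg_iff_add_eq_zero.1 h2
  have hL1 : L 1 = α - β := by
    simp [hLdef, stdAddChar_eq_neg_one hd hdd, sub_eq_add_neg]
  have hL0 {j : ZMod n} (hj : d * j = 0) : L j = α + β := by
    simp [hLdef, hj]
  have hne : α + β ≠ α - β := by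
    intro h
    have h2 : (2 : ℂ) * β = 0 := by linear_combination h
    exact hβ (by simpa using h2)
  -- `L 1` and `L 2` would both be `1`.
  have hnil : ¬ ∃ x : ZMod n, IsNilpotent x ∧ 2 * x ≠ 0 := by
    rintro ⟨x, hx, h2x⟩
    have hx0 : 1 * x ≠ 0 := fun h => h2x (by rw [one_mul] at h; simp [h])
    refine hne ?_
    rw [← hL1, ← hL0 (j := 2) (by rw [mul_two, hdd]),
      hone (eigenvalue_eq_zero_of_isNilpotent hx hx0),
      hone (eigenvalue_eq_zero_of_isNilpotent hx h2x)]
  have hdval : n = 2 * d.val := by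
    have h1 : n ∣ d.val + d.val := by
      rw [← ZMod.natCast_eq_zero_iff]
      simpa using hdd
    have h2 : 0 < d.val := Nat.pos_of_ne_zero fun h => hd ((ZMod.val_eq_zero d).1 h)
    have h3 := d.val_lt
    obtain ⟨c, hc⟩ := h1
    have : c = 1 := by
      have : c < 2 := by nlinarith
      have : c ≠ 0 := by rintro rfl; omega
      omega
    subst this
    omega
  -- As `m` is even, the indices `j + m k` all have the parity of `j`.
  have hpow {p m : ℕ} (hp : p.Prime) (hp2 : p ≠ 2) (hnm : n = p * m) (j : ZMod n) :
      L j ^ p = 1 := by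
    have h2m : 2 ∣ m := (Nat.Coprime.dvd_mul_left
      ((Nat.coprime_primes Nat.prime_two hp).2 hp2.symm)).1 (hnm ▸ ⟨_, hdval⟩)
    obtain ⟨r, rfl⟩ := h2m
    have h := hprod (Finset.range p) (fun k => j + (2 * r : ℕ) * (k : ZMod n))
      (sum_eigenvalue_add_mul_eq_zero hp.one_lt hnm j)
    have hc (k : ℕ) : L (j + (2 * r : ℕ) * (k : ZMod n)) = L j := by
      have : d * (j + (2 * r : ℕ) * (k : ZMod n)) = d * j := by
        push_cast
        linear_combination ((r : ZMod n) * k) * hdd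
      simp only [hLdef, this]
    simpa only [hc, Finset.prod_const, Finset.card_range] using h
  obtain ⟨m, hm⟩ : ∃ m, n = 2 * m := ⟨_, hdval⟩
  have hn0 := NeZero.pos n
  rcases Nat.even_or_odd m with ⟨r, hr⟩ | hodd
  · right
    have hn4 : n = 4 * r := by omega
    have hd2 : d * d = 0 := by
      have hdr : d = 2 * (r : ZMod n) := by
        have : d.val = 2 * r := by omega
        rw [← ZMod.natCast_zmod_val d, this]
        push_cast
        rfl
      nth_rewrite 2 [hdr]
      linear_combination (r : ZMod n) * hdd
    have hν : L 1 = 1 := hone <| eigenvalue_eq_zero_of_isNilpotent ⟨2, by rw [pow_two, hd2]⟩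
      (by rwa [one_mul])
    -- The relation `c_d + c_0 = 0`, together with `L d = L 0`.
    have hμ : L 0 ^ 2 = 1 := by
      have h := hprod (Finset.univ : Finset Bool) (fun i => if i then d else 0)
        (by simp [eigenvalue_eq_neg_eigenvalue_zero hd hdd])
      simp only [Fintype.prod_bool, if_true, Bool.false_eq_true, if_false] at h
      rwa [hL0 hd2, ← hL0 (mul_zero d), ← pow_two] at h
    by_cases hr1 : r = 1
    · exact ⟨2, Nat.prime_two, by omega⟩
    exfalso
    obtain ⟨p, hp, s, hs⟩ := Nat.exists_prime_and_dvd hr1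
    rcases eq_or_ne p 2 with rfl | hp2
    · refine hnil (exists_isNilpotent_two_mul_ne_zero (k := 4) (l := 2 * s) (e := 3) (by omega)
        (by omega) ⟨s ^ 2, ?_⟩)
      rw [hn4, hs]; ring
    · have hμp := hpow hp hp2 (show n = p * (4 * s) by rw [hn4, hs]; ring) 0
      have hcop : Nat.Coprime 2 p := (Nat.coprime_primes Nat.prime_two hp).2 hp2.symm
      have h1 : L 0 = 1 := by
        have := pow_gcd_eq_one.2 ⟨hμ, hμp⟩
        rwa [hcop.gcd_eq_one, pow_one] at this
      rw [hL0 (mul_zero d)] at h1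
      exact hne (by rw [h1, ← hL1, hν])
  · by_cases hm1 : m = 1
    · left; omega
    right
    obtain ⟨p, hp, s, hs⟩ := Nat.exists_prime_and_dvd hm1
    by_cases hs1 : s = 1
    · exact ⟨p, hp, by rw [hm, hs, hs1, mul_one]⟩
    exfalso
    obtain ⟨q, hq, r, hr⟩ := Nat.exists_prime_and_dvd hs1
    have hp2 : p ≠ 2 := by
      rintro rfl
      rw [hs] at hodd
      exact Nat.not_even_iff_odd.2 hodd (even_two_mul s)
    have hq2 : q ≠ 2 := by
      rintro rfl
      rw [hs, hr, mul_left_comm] at hodd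
      exact Nat.not_even_iff_odd.2 hodd (even_two_mul _)
    rcases eq_or_ne p q with rfl | hpq
    · refine hnil (exists_isNilpotent_two_mul_ne_zero (k := p) (l := 2 * p * r) (e := 2)
        (by have := hp.two_le; omega) ?_ ⟨2 * r, ?_⟩)
      · rw [hm, hs, hr]; ring
      · rw [hm, hs, hr]; ring
    · have h1 (j : ZMod n) : L j = 1 := by
        have := pow_gcd_eq_one.2
          ⟨hpow hp hp2 (show n = p * (2 * s) by rw [hm, hs]; ring) j,
          hpow hq hq2 (show n = q * (2 * p * r) by rw [hm, hs, hr]; ring) j⟩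
        rwa [((Nat.coprime_primes hp hq).2 hpq).gcd_eq_one, pow_one] at this
      exact hne (by rw [← hL1, ← hL0 (mul_zero d), h1, h1])

/-! ### Eigenvalues for `n = 2 p` -/

theorem natCast_half_ne_zero {m : ℕ} (hn : n = 2 * m) : (m : ZMod n) ≠ 0 := by
  have hn0 := NeZero.pos n
  rw [Ne, ZMod.natCast_eq_zero_iff]
  intro h
  have := Nat.le_of_dvd (by omega) h
  omega

theorem natCast_half_add_self {k m : ℕ} (hk : k = 2 * m) : (m : ZMod k) + m = 0 := by
  rw [← Nat.cast_add, ← two_mul, ← hk, ZMod.natCast_self]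

theorem stdAddChar_natCast_half {m : ℕ} (hn : n = 2 * m) : (stdAddChar (m : ZMod n) : ℂ) = -1 :=
  stdAddChar_eq_neg_one (natCast_half_ne_zero hn) (natCast_half_add_self hn)

theorem stdAddChar_half_mul {m : ℕ} (hn : n = 2 * m) (y : ZMod n) :
    (stdAddChar ((m : ZMod n) * y) : ℂ) = if Even y.val then 1 else -1 := by
  rw [← ZMod.natCast_zmod_val y, mul_comm, ← nsmul_eq_mul, AddChar.map_nsmul_eq_pow,
    stdAddChar_natCast_half hn, ZMod.natCast_zmod_val, neg_one_pow_eq_ite]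

/-- The factor `(1 - ψ(m y)) / 2` is the indicator function of the odd residues, so this is the
Fourier transform of that indicator function. -/
theorem sum_stdAddChar_mul_one_sub_half {m : ℕ} (hn : n = 2 * m) (j : ZMod n) :
    ∑ y : ZMod n, stdAddChar (j * y) * ((1 - stdAddChar ((m : ZMod n) * y)) / 2 : ℂ) =
      m * ((if j = 0 then 1 else 0) - if j = m then 1 else 0) := by
  have hsum (i : ZMod n) :
      ∑ y : ZMod n, (stdAddChar (i * y) : ℂ) = if i = 0 then (n : ℂ) else 0 := by
    have h := AddChar.sum_mulShift i (ZMod.isPrimitive_stdAddChar n)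
    rw [ZMod.card] at h
    simpa [mul_comm] using h
  have hterm (y : ZMod n) : stdAddChar (j * y) * ((1 - stdAddChar ((m : ZMod n) * y)) / 2 : ℂ) =
      (stdAddChar (j * y) - stdAddChar ((j + (m : ZMod n)) * y)) / 2 := by
    rw [add_mul, AddChar.map_add_eq_mul]
    ring
  have hj : j + m = 0 ↔ j = m := by
    rw [← natCast_half_add_self hn, add_left_inj]
  have hnm : (n : ℂ) = 2 * m := by exact_mod_cast congrArg (Nat.cast : ℕ → ℂ) hn
  simp only [hterm]
  rw [← Finset.sum_div, Finset.sum_sub_distrib, hsum, hsum]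
  simp only [hj, hnm]
  split_ifs <;> ring

theorem isUnit_iff_odd_and_coprime {m : ℕ} (hn : n = 2 * m) (y : ZMod n) :
    IsUnit y ↔ Odd y.val ∧ y.val.Coprime m := by
  rw [← ZMod.natCast_zmod_val y, ZMod.isUnit_iff_coprime, ZMod.natCast_zmod_val]
  generalize y.val = k
  rw [hn, Nat.coprime_mul_iff_right, Nat.coprime_two_right]

theorem eigenvalue_of_isUnit_iff_odd {m : ℕ} (hn : n = 2 * m)
    (h : ∀ y : ZMod n, IsUnit y ↔ Odd y.val) (j : ZMod n) :
    eigenvalue n j = m * ((if j = 0 then 1 else 0) - if j = m then 1 else 0) := by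
  rw [← sum_stdAddChar_mul_one_sub_half hn, eigenvalue]
  refine Finset.sum_congr rfl fun y _ => ?_
  rw [stdAddChar_half_mul hn]
  by_cases hy : Even y.val
  · simp [h, hy]
  · have hy' := Nat.not_even_iff_odd.1 hy
    simp only [h, hy, hy', if_true, if_false]
    norm_num

/-- The units modulo `2 p` are the odd residues except `p`, which accounts for the last
term. -/
theorem eigenvalue_two_mul_odd_prime {p : ℕ} (hp : p.Prime) (hodd : Odd p) (hn : n = 2 * p)
    (j : ZMod n) : eigenvalue n j =
      p * ((if j = 0 then 1 else 0) - if j = p then 1 else 0) - stdAddChar ((p : ZMod n) * j) := by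
  have hpval : (p : ZMod n).val = p := ZMod.val_cast_of_lt (by have := hp.pos; omega)
  have hlast : (stdAddChar ((p : ZMod n) * j) : ℂ) =
      ∑ y : ZMod n, if y = p then (stdAddChar (j * y) : ℂ) else 0 := by
    simp [mul_comm]
  rw [← sum_stdAddChar_mul_one_sub_half hn, eigenvalue, hlast, ← Finset.sum_sub_distrib]
  refine Finset.sum_congr rfl fun y _ => ?_
  rw [stdAddChar_half_mul hn]
  have hunit : IsUnit y ↔ Odd y.val ∧ y ≠ p := by
    rw [isUnit_iff_odd_and_coprime hn]
    refine and_congr_right fun hy => ?_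
    rw [Nat.coprime_comm, hp.coprime_iff_not_dvd, not_iff_not]
    constructor
    · rintro ⟨c, hc⟩
      have hlt := y.val_lt
      have hc2 : c < 2 := by
        have := hp.pos
        by_contra! h2
        have : p * 2 ≤ p * c := Nat.mul_le_mul_left p h2
        omega
      have hc0 : c ≠ 0 := by
        rintro rfl
        rw [hc, mul_zero] at hy
        simp at hy
      obtain rfl : c = 1 := by omega
      rw [← ZMod.natCast_zmod_val y, hc, mul_one]
    · rintro rfl
      rw [hpval]
  by_cases hy : Even y.val
  · have hy' := Nat.not_odd_iff_even.2 hy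
    have hyp : y ≠ p := by
      rintro rfl
      rw [hpval] at hy'
      exact hy' hodd
    simp [hunit, hy, hy', hyp]
  · have hy' := Nat.not_even_iff_odd.1 hy
    by_cases hyp : y = p
    · subst hyp
      simp only [hunit, hy, ne_eq, not_true_eq_false, and_false, if_true, if_false]
      norm_num
    · simp only [hunit, hy, hy', ne_eq, hyp, not_false_eq_true, and_self, if_true, if_false]
      norm_num

/-! ### Fractional revival for `n = 2 p` -/

theorem admitsFRAt_two_mul_odd_prime {p : ℕ} (hp : p.Prime) (hodd : Odd p) (hn : n = 2 * p) :
    AdmitsFRAt (unitaryCayleyGraph n) (2 * Real.pi / p) := by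
  have hp3 : 3 ≤ p := by
    have := hp.two_le
    obtain ⟨k, hk⟩ := hodd
    omega
  have hp0 : (0 : ℝ) < p := by positivity
  set t : ℝ := 2 * Real.pi / p with ht
  have ht0 : 0 < t := by positivity
  have htpi : t < Real.pi := by
    rw [ht, div_lt_iff₀ hp0]
    have : (3 : ℝ) ≤ p := by exact_mod_cast hp3
    nlinarith [Real.pi_pos]
  have hsin : Real.sin t ≠ 0 := (Real.sin_pos_of_pos_of_lt_pi ht0 htpi).ne'
  have htp : (t : ℂ) * p = 2 * Real.pi := by
    have : t * p = 2 * Real.pi := by rw [ht]; field_simp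
    exact_mod_cast this
  refine ⟨0, p, hasFRAt_zero_of_exp_eq (by omega) ht0 (natCast_half_ne_zero hn)
    (α := (Real.cos t : ℂ)) (β := (Real.sin t : ℂ) * I)
    (mul_ne_zero (by exact_mod_cast hsin) I_ne_zero) ?_ fun j => ?_⟩
  · rw [norm_mul, norm_I, mul_one, Complex.norm_real, Complex.norm_real, Real.norm_eq_abs,
      Real.norm_eq_abs, sq_abs, sq_abs, Real.cos_sq_add_sin_sq]
  · have hneg : -((p : ZMod n) * j) = p * j :=
      neg_eq_of_add_eq_zero_left (by rw [← add_mul, natCast_half_add_self hn, zero_mul])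
    -- The multiple of `p` in the eigenvalue contributes a multiple of `2πi` to the exponent.
    obtain ⟨e, he⟩ : ∃ e : ℤ, ((if j = 0 then 1 else 0) - if j = p then 1 else 0 : ℂ) = e :=
      ⟨(if j = 0 then 1 else 0) - if j = p then 1 else 0, by push_cast; rfl⟩
    rw [eigenvalue_two_mul_odd_prime hp hodd hn, he, hneg]
    have hexp (z : ℂ) : -(I * t) * (p * e - z) = t * z * I - e * (2 * Real.pi * I) := by
      linear_combination (-I * e) * htp
    rw [hexp, Complex.exp_periodic.sub_int_mul_eq, stdAddChar_half_mul hn, ofReal_cos, ofReal_sin]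
    split_ifs
    · rw [mul_one, mul_one, Complex.exp_mul_I]
    · rw [Complex.exp_mul_I, mul_neg_one, Complex.cos_neg, Complex.sin_neg]
      ring

theorem exp_neg_I_mul_pi_div_two : cexp (-(I * (Real.pi / 2 : ℝ))) = -I := by
  rw [show -(I * ((Real.pi / 2 : ℝ) : ℂ)) = ((-Real.pi / 2 : ℂ)) * I by push_cast; ring]
  exact Complex.exp_neg_pi_div_two_mul_I

theorem admitsFR_two : AdmitsFR (unitaryCayleyGraph 2) := by
  refine ⟨Real.pi / 2, 0, 1, hasFRAt_zero_of_exp_eq one_lt_two (by positivity) one_ne_zero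
    (α := 0) (β := -I) (by simp) (by simp) fun j => ?_⟩
  rw [eigenvalue_of_isUnit_iff_odd (n := 2) (m := 1) rfl (by decide)]
  have h1 := stdAddChar_natCast_half (n := 2) (m := 1) rfl
  rw [Nat.cast_one] at h1
  have h01 : (0 : ZMod 2) ≠ 1 := by decide
  have hcases : j = 0 ∨ j = 1 := by revert j; decide
  rw [Nat.cast_one, Nat.cast_one]
  rcases hcases with rfl | rfl
  · rw [if_pos rfl, if_neg h01]
    simpa using exp_neg_I_mul_pi_div_two
  · rw [if_neg h01.symm, if_pos rfl, mul_one, ZMod.neg_eq_self_mod_two, h1]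
    have h := inv_eq_iff_eq_inv.1 ((Complex.exp_neg _).symm.trans exp_neg_I_mul_pi_div_two)
    simpa using h

theorem admitsFR_four : AdmitsFR (unitaryCayleyGraph 4) := by
  have hunit : ∀ y : ZMod 4, IsUnit y ↔ Odd y.val := fun y => by
    rw [isUnit_iff_odd_and_coprime (m := 2) rfl, Nat.coprime_two_right, and_self]
  refine ⟨Real.pi / 2, 0, 2, hasFRAt_zero_of_exp_eq (by norm_num) (by positivity) (by decide)
    (α := 0) (β := -1) (by simp) (by simp) fun j => ?_⟩
  rw [eigenvalue_of_isUnit_iff_odd (n := 4) (m := 2) rfl hunit]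
  have hneg : -((2 : ZMod 4) * j) = (2 : ℕ) * j := by revert j; decide
  rw [hneg, stdAddChar_half_mul (n := 4) (m := 2) rfl]
  have hc : cexp (-(I * (Real.pi / 2 : ℝ)) * 2) = -1 := by
    rw [mul_comm, ← Nat.cast_two (R := ℂ), Complex.exp_nat_mul, exp_neg_I_mul_pi_div_two]
    simp
  have hc' : cexp (-(I * (Real.pi / 2 : ℝ)) * -2) = -1 := by
    rw [mul_neg, Complex.exp_neg, hc]
    norm_num
  have hcases : j = 0 ∨ j = (2 : ℕ) ∨ (j ≠ 0 ∧ j ≠ (2 : ℕ) ∧ ¬ Even j.val) := by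
    revert j; decide
  rcases hcases with rfl | rfl | ⟨h0, h2, hodd⟩
  · have h02 : ¬ ((0 : ZMod 4) = (2 : ℕ)) := by decide
    rw [if_neg h02, if_pos rfl, if_pos (by decide)]
    simpa using hc
  · have h20 : ¬ (((2 : ℕ) : ZMod 4) = 0) := by decide
    have hev : Even ((2 : ℕ) : ZMod 4).val := by decide
    rw [if_neg h20, if_pos rfl, if_pos hev]
    simpa using hc'
  · rw [if_neg h0, if_neg h2, if_neg hodd]
    simp

theorem AdmitsFR.admitsPGFR {V : Type*} [Fintype V] [DecidableEq V] {G : SimpleGraph V}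
    (h : AdmitsFR G) : AdmitsPGFR G := by
  obtain ⟨t, a, b, hab, -, α, β, hβ, hαβ, h⟩ := h
  exact ⟨a, b, hab, α, β, hβ, hαβ, fun _ => t, by simp only [h]; exact tendsto_const_nhds⟩

theorem admitsFR_of_eq_two_mul_prime (h : n = 2 ∨ ∃ p : ℕ, p.Prime ∧ n = 2 * p) :
    AdmitsFR (unitaryCayleyGraph n) := by
  rcases h with rfl | ⟨p, hp, hn⟩
  · convert admitsFR_two
  · rcases hp.eq_two_or_odd' with rfl | hodd
    · subst hn
      convert admitsFR_four
    · exact ⟨_, admitsFRAt_two_mul_odd_prime hp hodd hn⟩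

end QuantumWalk

theorem mainTheorem2 (n : ℕ) [NeZero n] :
    (QuantumWalk.AdmitsFR (QuantumWalk.unitaryCayleyGraph n) ↔
      QuantumWalk.AdmitsPGFR (QuantumWalk.unitaryCayleyGraph n)) ∧
    (QuantumWalk.AdmitsPGFR (QuantumWalk.unitaryCayleyGraph n) ↔
      (n = 2 ∨ ∃ p : ℕ, p.Prime ∧ n = 2 * p)) ∧
    (∀ p : ℕ, p.Prime → Odd p → n = 2 * p →
      QuantumWalk.AdmitsFRAt (QuantumWalk.unitaryCayleyGraph n) (2 * Real.pi / p)) := by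
  have hnec : QuantumWalk.AdmitsPGFR (QuantumWalk.unitaryCayleyGraph n) →
      (n = 2 ∨ ∃ p : ℕ, p.Prime ∧ n = 2 * p) := fun ⟨_, _, h⟩ => h.eq_two_mul_prime
  exact ⟨⟨fun h => h.admitsPGFR, fun h => QuantumWalk.admitsFR_of_eq_two_mul_prime (hnec h)⟩,
    ⟨hnec, fun h => (QuantumWalk.admitsFR_of_eq_two_mul_prime h).admitsPGFR⟩,
    fun _ hp hodd hn => QuantumWalk.admitsFRAt_two_mul_odd_prime hp hodd hn⟩
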